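/- Let \(n\ge 2\), let \(\Omega\subset\mathbb R^n\) be a bounded open set (for instance a connected bounded Lipschitz domain), let \(f\in L^2(\Omega)\), \(0<\underline\kappa<\overline\kappa<\infty\) and \(\gamma\in(\underline\kappa,\overline\kappa)\). Local problem. Let \(\mathbb A\) be the set of \(\kappa\in L^\infty(\Omega)\) with \(\kappa\in[\underline\kappa,\overline\kappa]\) a.e. in \(\Omega\) and \(\int_\Omega\kappa\,dx\le\gamma|\Omega|\), let \(\mathbb Q(f)=\{q\in H(\mathrm{div},\Omega;\mathbb R^n):\mathrm{div}\,q=f\}\), and let \[d^*=\inf_{(\kappa,q)\in\mathbb A\times\mathbb Q(f)}\frac12\int_\Omega\kappa^{-1}(x)|q(x)|^2\,dx .\] Nonlocal problem. For \(\delta>0\) let \(\Omega_\delta=\bigcup_{x\in\Omega}B(x,\delta)\), and let \(\omega_\delta:\mathbb R^n\to[0,\infty)\) be a radial measurable function that vanishes outside \(B(0,\delta)\) and satisfies \(\int_{\mathbb R^n}|x|^2\omega_\delta^2(x)\,dx=K_{2,n}^{-1}\), where \(K_{2,n}=|\mathbb S^{n-1}|^{-1}\int_{\mathbb S^{n-1}}|s\cdot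 e|^2\,ds\) for a unit vector \(e\). For \(u\in L^2(\Omega)\), extended by zero outside \(\Omega\), put \(\mathcal G_\delta u(x,x')=[u(x)-u(x')]\,\omega_\delta(x-x')\), and let \(\mathbb U_{\delta,0}\) be the set of \(u\in L^2(\Omega)\) with \(\mathcal G_\delta u\in L^2(\Omega_\delta\times\Omega_\delta)\). Let \(\mathbb Q_\delta(f)\) be the set of \(q\in L^2(\Omega_\delta\times\Omega_\delta)\) with \(\mathcal D_\delta q=f\), where \(\mathcal D_\delta\) is the negative adjoint of \(\mathcal G_\delta\); that is, \(\int_\Omega f v\,dx=-\int_{\Omega_\delta}\int_{\Omega_\delta}q\,\mathcal G_\delta v\,dx\,dx'\) for all \(v\in\mathbb U_{\delta,0}\). Let \(\mathbb A_\delta\) be the set of \(\kappa\in L^\infty(\Omega_\delta)\) with \(\kappa|_\Omega\in\mathbb A\) and \(\kappa\in[\underline\kappa,\overline\kappa]\) a.e. in \(\Omega_\delta\setminus\Omega\). With the harmonic average \(\ddot\kappa(x,x')=2\kappa(x)\kappa(x')/(\kappa(x)+\kappa(x'))\), let \[d^*_\delta=\inf_{(\kappa,q)\in\mathbb A_\delta\times\mathbb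 Q_\delta(f)}\frac12\int_{\Omega_\delta}\int_{\Omega_\delta}\ddot\kappa^{-1}(x,x')\,|q(x,x')|^2\,dx\,dx' .\] Infima are taken in the extended reals, with \(\inf\emptyset=+\infty\). Then \[d^*\le\liminf_{\delta\searrow0}d^*_\delta .\] -/

import Mathlib

open MeasureTheory Filter Topology
open scoped ContDiff

noncomputable section

namespace NonlocalDesign

/-- Euclidean space `ℝⁿ`. -/
abbrev E (n : ℕ) : Type := EuclideanSpace ℝ (Fin n)

/-! ### The local problem -/

/-- The admissible conductivities `𝔸` on `Ω`: essentially bounded, with values a.e. in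
`[kmin, kmax]`, and of mean at most `γ`. -/
def Conductivities {n : ℕ} (Ω : Set (E n)) (kmin kmax γ : ℝ) : Set (E n → ℝ) :=
  {κ | MemLp κ ⊤ (volume.restrict Ω) ∧
    (∀ᵐ x ∂volume.restrict Ω, κ x ∈ Set.Icc kmin kmax) ∧
    ∫ x in Ω, κ x ≤ γ * volume.real Ω}

/-- `g` is the distributional divergence of the vector field `q` on `Ω`. -/
def IsWeakDiv {n : ℕ} (Ω : Set (E n)) (q : E n → E n) (g : E n → ℝ) : Prop :=
  ∀ φ : E n → ℝ, ContDiff ℝ ∞ φ → HasCompactSupport φ → tsupport φ ⊆ Ω →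
    ∫ x in Ω, inner ℝ (q x) (gradient φ x) = -∫ x in Ω, g x * φ x

/-- The space `H(div, Ω; ℝⁿ)`. -/
def HDiv {n : ℕ} (Ω : Set (E n)) : Set (E n → E n) :=
  {q | MemLp q 2 (volume.restrict Ω) ∧
    ∃ g : E n → ℝ, MemLp g 2 (volume.restrict Ω) ∧ IsWeakDiv Ω q g}

/-- The local fluxes `ℚ(f)`: the elements of `H(div, Ω; ℝⁿ)` with divergence `f`. -/
def LocalFluxes {n : ℕ} (Ω : Set (E n)) (f : E n → ℝ) : Set (E n → E n) :=
  {q | q ∈ HDiv Ω ∧ IsWeakDiv Ω q f}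

/-- The local complementary energy `½ ∫_Ω κ⁻¹ |q|²`. -/
def localEnergy {n : ℕ} (Ω : Set (E n)) (κ : E n → ℝ) (q : E n → E n) : ℝ :=
  (1 / 2) * ∫ x in Ω, (κ x)⁻¹ * ‖q x‖ ^ 2

/-- The optimal value `d*` of the local dual problem, as an infimum in the extended reals. -/
def localDualValue {n : ℕ} (Ω : Set (E n)) (kmin kmax γ : ℝ) (f : E n → ℝ) : EReal :=
  ⨅ κ ∈ Conductivities Ω kmin kmax γ, ⨅ q ∈ LocalFluxes Ω f,
    ((localEnergy Ω κ q : ℝ) : EReal)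

/-! ### The nonlocal problem with horizon `δ`

The set `Ω_δ = ⋃ x ∈ Ω, B(x, δ)` is `Metric.thickening δ Ω`. -/

/-- The constant `K_{2,n}`, the average of `|s · e|²` over the unit sphere, for a unit vector
`e`. -/
def sphereMoment {n : ℕ} (e : E n) : ℝ :=
  ((volume : Measure (E n)).toSphere.real Set.univ)⁻¹ *
    ∫ s : Metric.sphere (0 : E n) 1, |inner ℝ (s : E n) e| ^ 2 ∂(volume : Measure (E n)).toSphere

/-- `w` is an admissible interaction kernel with horizon `δ`: nonnegative, radial, supported in
`B(0, δ)`, and normalized by `∫ |x|² w(x)² dx = K_{2,n}⁻¹`. -/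
structure IsKernel {n : ℕ} (e : E n) (δ : ℝ) (w : E n → ℝ) : Prop where
  measurable : Measurable w
  nonneg : ∀ x, 0 ≤ w x
  radial : ∀ x y, ‖x‖ = ‖y‖ → w x = w y
  support_subset : Function.support w ⊆ Metric.ball 0 δ
  integrable : Integrable fun x => ‖x‖ ^ 2 * w x ^ 2
  normalized : ∫ x, ‖x‖ ^ 2 * w x ^ 2 = (sphereMoment e)⁻¹

/-- Lebesgue measure on `Ω_δ × Ω_δ`. -/
def pairMeasure {n : ℕ} (Ω : Set (E n)) (δ : ℝ) : Measure (E n × E n) :=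
  (volume : Measure (E n × E n)).restrict (Metric.thickening δ Ω ×ˢ Metric.thickening δ Ω)

/-- The nonlocal gradient `(u(x) - u(x')) w(x - x')` of a function `u` on `Ω`, where `u` is
extended by zero outside `Ω`. -/
def nonlocalGrad {n : ℕ} (Ω : Set (E n)) (w : E n → ℝ) (u : E n → ℝ) (z : E n × E n) : ℝ :=
  (Ω.indicator u z.1 - Ω.indicator u z.2) * w (z.1 - z.2)

/-- The domain `𝕌_{δ,0}` of the nonlocal gradient. -/
def GradDomain {n : ℕ} (Ω : Set (E n)) (δ : ℝ) (w : E n → ℝ) : Set (E n → ℝ) :=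
  {u | MemLp u 2 (volume.restrict Ω) ∧ MemLp (nonlocalGrad Ω w u) 2 (pairMeasure Ω δ)}

/-- `g` is the nonlocal divergence of the two-point flux `q`, i.e. its image under the negative
adjoint of the nonlocal gradient. -/
def IsNonlocalDiv {n : ℕ} (Ω : Set (E n)) (δ : ℝ) (w : E n → ℝ)
    (q : E n × E n → ℝ) (g : E n → ℝ) : Prop :=
  ∀ v ∈ GradDomain Ω δ w,
    ∫ x in Ω, g x * v x = -∫ z, q z * nonlocalGrad Ω w v z ∂pairMeasure Ω δ

/-- The domain `ℚ_δ` of the nonlocal divergence. -/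
def NonlocalHDiv {n : ℕ} (Ω : Set (E n)) (δ : ℝ) (w : E n → ℝ) : Set (E n × E n → ℝ) :=
  {q | MemLp q 2 (pairMeasure Ω δ) ∧
    ∃ g : E n → ℝ, MemLp g 2 (volume.restrict Ω) ∧ IsNonlocalDiv Ω δ w q g}

/-- The nonlocal fluxes `ℚ_δ(f)`: the two-point fluxes with nonlocal divergence `f`. -/
def NonlocalFluxes {n : ℕ} (Ω : Set (E n)) (δ : ℝ) (w : E n → ℝ) (f : E n → ℝ) :
    Set (E n × E n → ℝ) :=
  {q | q ∈ NonlocalHDiv Ω δ w ∧ IsNonlocalDiv Ω δ w q f}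

/-- The admissible conductivities `𝔸_δ` on `Ω_δ`. -/
def NonlocalConductivities {n : ℕ} (Ω : Set (E n)) (kmin kmax γ : ℝ) (δ : ℝ) :
    Set (E n → ℝ) :=
  {κ | MemLp κ ⊤ (volume.restrict (Metric.thickening δ Ω)) ∧
    κ ∈ Conductivities Ω kmin kmax γ ∧
    ∀ᵐ x ∂volume.restrict (Metric.thickening δ Ω \ Ω), κ x ∈ Set.Icc kmin kmax}

/-- The two-point conductivity: the harmonic average of `κ(x)` and `κ(x')`. -/
def harmonicAvg {n : ℕ} (κ : E n → ℝ) (z : E n × E n) : ℝ :=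
  2 * κ z.1 * κ z.2 / (κ z.1 + κ z.2)

/-- The nonlocal complementary energy of a two-point flux. -/
def nonlocalEnergy {n : ℕ} (Ω : Set (E n)) (δ : ℝ) (κ : E n → ℝ) (q : E n × E n → ℝ) : ℝ :=
  (1 / 2) * ∫ z, (harmonicAvg κ z)⁻¹ * q z ^ 2 ∂pairMeasure Ω δ

/-- The optimal value `d*_δ` of the nonlocal dual problem, as an infimum in the extended
reals. -/
def nonlocalDualValue {n : ℕ} (Ω : Set (E n)) (kmin kmax γ : ℝ) (f : E n → ℝ)
    (δ : ℝ) (w : E n → ℝ) : EReal :=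
  ⨅ κ ∈ NonlocalConductivities Ω kmin kmax γ δ, ⨅ q ∈ NonlocalFluxes Ω δ w f,
    ((nonlocalEnergy Ω δ κ q : ℝ) : EReal)

end NonlocalDesign

end

/-! A nonlocal design is turned into a local one at no cost in energy. From a two-point flux `q`
take its antisymmetric part `qᵃ` and form the vector field `p(x) = ∫ qᵃ(x,y) w(x-y) (x-y) dy`.

Energy: Cauchy–Schwarz in the direction `p(x)`, with the normalization of the kernel, which makes
each directional second moment at most `1`, gives `|p(x)|² ≤ ∫ qᵃ(x,y)² dy` with constant exactly
one (`IsKernel.norm_fluxDensity_sq_le`). The reciprocal of the harmonic average is the mean of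
`κ(x)⁻¹` and `κ(y)⁻¹`, the very weight that antisymmetrization produces, so the local energy of `p`
is at most the nonlocal energy of `q`.

Divergence: for a test function `φ`, `φ(x) - φ(y)` is `(x-y)·∇φ(x)` up to `L|x-y|²`, and `|x-y| < δ`
on the support of the kernel. Hence `-div p` and `-f` agree on `φ` up to `O(δ)`, uniformly under an
energy bound (`IsKernel.exists_local_flux`).

Limit: if nonlocal values lie below `M` for arbitrarily small `δ`, the pairs `(κ, p)` are bounded in
`L²` and converge weakly along an ultrafilter. The linear constraints survive, the divergence error
vanishes, and the energy is weakly lower semicontinuous because `|p|²/κ` is a supremum of functions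
affine in `(κ, p)` (`exists_weak_limit`). -/

/-! ### Weak compactness and Cauchy–Schwarz in L². -/

section Auxiliary

/-- Bounded families in a Hilbert space converge weakly along ultrafilters. -/
theorem exists_tendsto_inner_of_norm_le {ι H : Type*} [NormedAddCommGroup H]
    [InnerProductSpace ℝ H] [CompleteSpace H] (U : Ultrafilter ι) (x : ι → H) (C : ℝ)
    (hx : ∀ᶠ i in (U : Filter ι), ‖x i‖ ≤ C) :
    ∃ y : H, ∀ v : H, Tendsto (fun i => inner ℝ (x i) v) U (𝓝 (inner ℝ y v)) := by
  let T : ι → WeakDual ℝ H := fun i =>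
    StrongDual.toWeakDual (InnerProductSpace.toDual ℝ H (x i))
  have hK := WeakDual.isCompact_closedBall (𝕜 := ℝ) (E := H) 0 C
  obtain ⟨t, -, ht⟩ := hK.ultrafilter_le_nhds (U.map T) (by
    rw [Ultrafilter.coe_map, le_principal_iff, mem_map]
    filter_upwards [hx] with i hi
    simpa [T] using hi)
  refine ⟨(InnerProductSpace.toDual ℝ H).symm (WeakDual.toStrongDual t), fun v => ?_⟩
  have h : Tendsto T U (𝓝 t) := ht
  have h2 := ((WeakDual.eval_continuous v).tendsto t).comp h
  have e1 : (inner ℝ ((InnerProductSpace.toDual ℝ H).symm (WeakDual.toStrongDual t)) v) = t v := by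
    rw [InnerProductSpace.toDual_symm_apply]; rfl
  rw [e1]
  exact h2

theorem MeasureTheory.MemLp.inner_toLp_eq_integral {α F : Type*} [MeasurableSpace α]
    {μ : Measure α} [NormedAddCommGroup F] [InnerProductSpace ℝ F] {f g : α → F}
    (hf : MemLp f 2 μ) (hg : MemLp g 2 μ) :
    inner ℝ (hf.toLp f) (hg.toLp g) = ∫ x, inner ℝ (f x) (g x) ∂μ := by
  rw [L2.inner_def]
  refine integral_congr_ae ?_
  filter_upwards [hf.coeFn_toLp, hg.coeFn_toLp] with x h1 h2
  rw [h1, h2]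

theorem MeasureTheory.MemLp.integrable_inner_of_two {α F : Type*} [MeasurableSpace α]
    {μ : Measure α} [NormedAddCommGroup F] [InnerProductSpace ℝ F] {f g : α → F}
    (hf : MemLp f 2 μ) (hg : MemLp g 2 μ) :
    Integrable (fun x => inner ℝ (f x) (g x)) μ := by
  refine (L2.integrable_inner (𝕜 := ℝ) (hf.toLp f) (hg.toLp g)).congr ?_
  filter_upwards [hf.coeFn_toLp, hg.coeFn_toLp] with x h1 h2
  rw [h1, h2]

theorem MeasureTheory.MemLp.norm_toLp_sq {α F : Type*} [MeasurableSpace α]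
    {μ : Measure α} [NormedAddCommGroup F] [InnerProductSpace ℝ F] {f : α → F}
    (hf : MemLp f 2 μ) : ‖hf.toLp f‖ ^ 2 = ∫ x, ‖f x‖ ^ 2 ∂μ := by
  rw [← real_inner_self_eq_norm_sq, hf.inner_toLp_eq_integral hf]
  simp only [real_inner_self_eq_norm_sq]

/-- The Cauchy–Schwarz inequality in `L²`. -/
theorem MeasureTheory.MemLp.sq_integral_mul_le {α : Type*} [MeasurableSpace α]
    {μ : Measure α} {f g : α → ℝ} (hf : MemLp f 2 μ) (hg : MemLp g 2 μ) :
    (∫ x, f x * g x ∂μ) ^ 2 ≤ (∫ x, f x ^ 2 ∂μ) * ∫ x, g x ^ 2 ∂μ := by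
  have h := abs_real_inner_le_norm (hf.toLp f) (hg.toLp g)
  have h1 := hf.norm_toLp_sq
  have h2 := hg.norm_toLp_sq
  have h3 : ∫ x, f x * g x ∂μ = inner ℝ (hf.toLp f) (hg.toLp g) := by
    rw [hf.inner_toLp_eq_integral hg]
    exact integral_congr_ae (ae_of_all _ fun x => by simp [mul_comm])
  simp only [Real.norm_eq_abs, sq_abs] at h1 h2
  rw [h3, ← h1, ← h2, ← mul_pow, ← sq_abs]
  gcongr

/-- Bounded families in `L²` converge weakly along ultrafilters. -/
theorem exists_memLp_tendsto_integral_inner {ι α F : Type*} [MeasurableSpace α]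
    {μ : Measure α} [NormedAddCommGroup F] [InnerProductSpace ℝ F] [CompleteSpace F]
    (U : Ultrafilter ι) (p : ι → α → F) (hp : ∀ i, MemLp (p i) 2 μ) (C : ℝ)
    (hC : ∀ᶠ i in (U : Filter ι), ∫ x, ‖p i x‖ ^ 2 ∂μ ≤ C) :
    ∃ p₀ : α → F, MemLp p₀ 2 μ ∧ ∀ v : α → F, MemLp v 2 μ →
      Tendsto (fun i => ∫ x, inner ℝ (p i x) (v x) ∂μ) U (𝓝 (∫ x, inner ℝ (p₀ x) (v x) ∂μ)) := by
  obtain ⟨y, hy⟩ := exists_tendsto_inner_of_norm_le U (fun i => (hp i).toLp (p i)) (Real.sqrt C) (by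
    filter_upwards [hC] with i hi
    refine Real.le_sqrt_of_sq_le ?_
    rwa [(hp i).norm_toLp_sq])
  refine ⟨y, Lp.memLp y, fun v hv => ?_⟩
  have h := hy (hv.toLp v)
  have h2 : inner ℝ y (hv.toLp v) = ∫ x, inner ℝ (y x) (v x) ∂μ := by
    rw [← (Lp.memLp y).inner_toLp_eq_integral hv, Lp.toLp_coeFn]
  rw [h2] at h
  refine h.congr fun i => ?_
  exact (hp i).inner_toLp_eq_integral hv

end Auxiliary

namespace NonlocalDesign

/-! ### Second moments of radial kernels. -/

section Moments

/-- Polar coordinates for functions that separate into an angular and a radial part. -/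
theorem integral_eq_toSphere_mul {n : ℕ} [Nontrivial (E n)] (F : E n → ℝ) (a : E n → ℝ)
    (b : ℝ → ℝ) (hF : ∀ x : E n, x ≠ 0 → F x = a (‖x‖⁻¹ • x) * b ‖x‖) :
    ∫ x, F x = (∫ s : Metric.sphere (0 : E n) 1, a s ∂(volume : Measure (E n)).toSphere) *
      ∫ r : Set.Ioi (0 : ℝ), b r ∂(Measure.volumeIoiPow (Module.finrank ℝ (E n) - 1)) := by
  calc
    ∫ x, F x = ∫ x : ({(0)}ᶜ : Set (E n)), F x.1 ∂((volume : Measure (E n)).comap (↑)) := by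
      rw [integral_subtype_comap (measurableSet_singleton _).compl F, restrict_compl_singleton]
    _ = ∫ x : ({(0)}ᶜ : Set (E n)), a (‖x.1‖⁻¹ • x.1) * b ‖x.1‖
          ∂((volume : Measure (E n)).comap (↑)) :=
      integral_congr_ae (ae_of_all _ fun x => hF x.1 x.2)
    _ = ∫ x, a x.1 * b x.2 ∂(volume : Measure (E n)).toSphere.prod
          (.volumeIoiPow (Module.finrank ℝ (E n) - 1)) := by
      simpa using (volume : Measure (E n)).measurePreserving_homeomorphUnitSphereProd.integral_comp
        (Homeomorph.measurableEmbedding _) (fun x => a x.1 * b x.2)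
    _ = _ := integral_prod_mul (fun s : Metric.sphere (0 : E n) 1 => a s)
        (fun r : Set.Ioi (0 : ℝ) => b r)

variable {n : ℕ} {e : E n} {δ : ℝ} {w : E n → ℝ}

theorem IsKernel.integrable_inner_sq (hw : IsKernel e δ w) (v : E n) :
    Integrable fun x => inner ℝ x v ^ 2 * w x ^ 2 := by
  refine (hw.integrable.const_mul (‖v‖ ^ 2)).mono' ?_ (ae_of_all _ fun x => ?_)
  · have := hw.measurable
    exact Measurable.aestronglyMeasurable (by fun_prop)
  · rw [Real.norm_of_nonneg (by positivity), ← mul_assoc]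
    gcongr
    rw [← mul_pow, ← sq_abs, mul_comm]
    gcongr
    exact abs_real_inner_le_norm x v

/-- A radial kernel has the same second moment in all directions. -/
theorem IsKernel.integral_inner_sq_eq_of_norm_eq (hw : IsKernel e δ w) {u v : E n}
    (h : ‖u‖ = ‖v‖) :
    ∫ x, inner ℝ x u ^ 2 * w x ^ 2 = ∫ x, inner ℝ x v ^ 2 * w x ^ 2 := by
  let T : E n ≃ₗᵢ[ℝ] E n := (ℝ ∙ (u - v))ᗮ.reflection
  have hT : T u = v := Submodule.reflection_sub h
  rw [← T.measurePreserving.integral_comp T.toHomeomorph.measurableEmbedding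
    (fun x => inner ℝ x v ^ 2 * w x ^ 2)]
  refine integral_congr_ae (ae_of_all _ fun x => ?_)
  simp only
  rw [← hT, T.inner_map_map, hw.radial (T x) x (T.norm_map x)]

/-- In polar coordinates both integrals have the same radial factor, so only their angular factors
differ; the quotient of these is the spherical average. -/
theorem IsKernel.integral_inner_self_sq (hw : IsKernel e δ w) (he : ‖e‖ = 1) :
    ∫ x, inner ℝ x e ^ 2 * w x ^ 2 = sphereMoment e * ∫ x, ‖x‖ ^ 2 * w x ^ 2 := by
  have he0 : e ≠ 0 := by rintro rfl; simp at he
  have : Nontrivial (E n) := ⟨⟨e, 0, he0⟩⟩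
  have hr : ∀ x, w x = w (‖x‖ • e) := fun x => hw.radial _ _ (by simp [norm_smul, he])
  have h1 := integral_eq_toSphere_mul (fun x => inner ℝ x e ^ 2 * w x ^ 2)
    (fun s => |inner ℝ s e| ^ 2) (fun r => r ^ 2 * w (r • e) ^ 2) (fun x hx => by
      have : ‖x‖ ≠ 0 := norm_ne_zero_iff.2 hx
      rw [hr x, sq_abs, real_inner_smul_left]
      field_simp)
  have h2 := integral_eq_toSphere_mul (fun x => ‖x‖ ^ 2 * w x ^ 2)
    (fun _ => 1) (fun r => r ^ 2 * w (r • e) ^ 2) (fun x hx => by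
      rw [one_mul, ← hr x])
  have h3 : (volume : Measure (E n)).toSphere.real Set.univ ≠ 0 := by
    rw [Measure.real, ENNReal.toReal_ne_zero]
    exact ⟨Measure.measure_univ_ne_zero.2 (Measure.toSphere_ne_zero _), measure_ne_top _ _⟩
  simp only [integral_const, smul_eq_mul, mul_one] at h2
  rw [h1, h2, sphereMoment]
  field_simp

theorem IsKernel.integral_inner_sq_le (hw : IsKernel e δ w) (he : ‖e‖ = 1) (v : E n) :
    ∫ x, inner ℝ x v ^ 2 * w x ^ 2 ≤ ‖v‖ ^ 2 := by
  have h : ∫ x, inner ℝ x v ^ 2 * w x ^ 2 = ‖v‖ ^ 2 * ∫ x, inner ℝ x e ^ 2 * w x ^ 2 := by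
    rw [hw.integral_inner_sq_eq_of_norm_eq (u := v) (v := ‖v‖ • e) (by simp [norm_smul, he]),
      ← integral_const_mul]
    refine integral_congr_ae (ae_of_all _ fun x => ?_)
    simp only [real_inner_smul_right]
    ring
  rw [h, hw.integral_inner_self_sq he, hw.normalized]
  -- Since `0⁻¹ = 0`, `K * K⁻¹ ≤ 1` holds without knowing that `K ≠ 0`, and an upper bound is all
  -- that is needed.
  exact mul_le_of_le_one_right (by positivity) (mul_inv_le_one)

end Moments

/-! ### The vector field induced by a two-point flux. -/

section FluxDensity

variable {n : ℕ} {e : E n} {δ : ℝ} {w : E n → ℝ}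

/-- The vector field `x ↦ ∫ q(x, y) w(x - y) (x - y) dy` of a two-point flux `q`. -/
noncomputable def fluxDensity (μ : Measure (E n)) (w : E n → ℝ) (q : E n × E n → ℝ) (x : E n) : E n :=
  ∫ y, (q (x, y) * w (x - y)) • (x - y) ∂μ

theorem integrable_restrict_sub_left {G : E n → ℝ} (hG : Integrable G) (S : Set (E n)) (x : E n) :
    Integrable (fun y => G (x - y)) (volume.restrict S) :=
  (hG.comp_sub_left x).restrict

theorem integral_restrict_sub_left_le {G : E n → ℝ} (hG : Integrable G) (h0 : ∀ x, 0 ≤ G x)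
    (S : Set (E n)) (x : E n) : ∫ y in S, G (x - y) ≤ ∫ y, G y := by
  rw [← integral_sub_left_eq_self G volume x]
  exact setIntegral_le_integral (hG.comp_sub_left x) (ae_of_all _ fun y => h0 _)

theorem IsKernel.memLp_sub_left (hw : IsKernel e δ w) (S : Set (E n)) (x : E n) :
    MemLp (fun y => ‖x - y‖ * w (x - y)) 2 (volume.restrict S) := by
  have hm := hw.measurable
  rw [memLp_two_iff_integrable_sq (Measurable.aestronglyMeasurable (by fun_prop))]
  simp only [mul_pow]
  exact integrable_restrict_sub_left hw.integrable S x

theorem IsKernel.memLp_inner_sub_left (hw : IsKernel e δ w) (S : Set (E n)) (x v : E n) :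
    MemLp (fun y => inner ℝ (x - y) v * w (x - y)) 2 (volume.restrict S) := by
  have hm := hw.measurable
  rw [memLp_two_iff_integrable_sq (Measurable.aestronglyMeasurable (by fun_prop))]
  simp only [mul_pow]
  exact integrable_restrict_sub_left (hw.integrable_inner_sq v) S x

/-- For each `x` the integral in `y` is at most the full second moment, whatever `δ` is. This
dominates the nonlocal gradients of Lipschitz functions. -/
theorem IsKernel.memLp_prod (hw : IsKernel e δ w) {S : Set (E n)}
    (hS : volume S ≠ ⊤) :
    MemLp (fun z : E n × E n => ‖z.1 - z.2‖ * w (z.1 - z.2)) 2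
      ((volume.restrict S).prod (volume.restrict S)) ∧
    ∫ z : E n × E n, (‖z.1 - z.2‖ * w (z.1 - z.2)) ^ 2
      ∂((volume.restrict S).prod (volume.restrict S)) ≤
        volume.real S * (sphereMoment e)⁻¹ := by
  have hm := hw.measurable
  have : IsFiniteMeasure (volume.restrict S) := ⟨by simpa using hS.lt_top⟩
  have hb : ∀ x, ∫ y in S, (‖x - y‖ * w (x - y)) ^ 2 ≤ (sphereMoment e)⁻¹ := fun x => by
    simp only [mul_pow]
    rw [← hw.normalized]
    exact integral_restrict_sub_left_le hw.integrable (fun x => by positivity) S x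
  have hme : Measurable (fun z : E n × E n => (‖z.1 - z.2‖ * w (z.1 - z.2))) := by fun_prop
  have hi : Integrable (fun z : E n × E n => (‖z.1 - z.2‖ * w (z.1 - z.2)) ^ 2)
      ((volume.restrict S).prod (volume.restrict S)) := by
    rw [integrable_prod_iff (hme.pow_const 2).aestronglyMeasurable]
    refine ⟨ae_of_all _ fun x => (hw.memLp_sub_left S x).integrable_sq, ?_⟩
    refine Integrable.mono' (integrable_const (sphereMoment e)⁻¹) ?_ (ae_of_all _ fun x => ?_)
    · exact ((hme.pow_const 2).norm.aestronglyMeasurable).integral_prod_right'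
    · rw [Real.norm_of_nonneg (integral_nonneg fun _ => norm_nonneg _)]
      simpa only [norm_pow, Real.norm_eq_abs, sq_abs] using hb x
  refine ⟨(memLp_two_iff_integrable_sq hme.aestronglyMeasurable).2 hi, ?_⟩
  rw [integral_prod _ hi]
  calc _ ≤ ∫ x in S, (sphereMoment e)⁻¹ :=
        integral_mono hi.integral_prod_left (integrable_const _) hb
    _ = _ := by simp

theorem aestronglyMeasurable_fluxDensity_aux {S : Set (E n)} (hm : Measurable w)
    {q : E n × E n → ℝ} (hq : AEStronglyMeasurable q
      ((volume.restrict S).prod (volume.restrict S))) :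
    AEStronglyMeasurable (fun z : E n × E n => (q z * w (z.1 - z.2)) • (z.1 - z.2))
      ((volume.restrict S).prod (volume.restrict S)) := by
  refine (hq.mul (Measurable.aestronglyMeasurable (by fun_prop))).smul
    (Measurable.aestronglyMeasurable (by fun_prop))

theorem aestronglyMeasurable_fluxDensity {S : Set (E n)} (hm : Measurable w)
    {q : E n × E n → ℝ} (hq : AEStronglyMeasurable q
      ((volume.restrict S).prod (volume.restrict S))) :
    AEStronglyMeasurable (fluxDensity (volume.restrict S) w q) (volume.restrict S) :=
  (aestronglyMeasurable_fluxDensity_aux hm hq).integral_prod_right'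

theorem ae_memLp_section {S : Set (E n)} {q : E n × E n → ℝ}
    (hq : MemLp q 2 ((volume.restrict S).prod (volume.restrict S))) :
    ∀ᵐ x ∂volume.restrict S, MemLp (fun y => q (x, y)) 2 (volume.restrict S) := by
  filter_upwards [hq.integrable_sq.prod_right_ae, hq.1.prodMk_left] with x h1 h2
  exact (memLp_two_iff_integrable_sq h2).2 h1

theorem IsKernel.inner_fluxDensity (hw : IsKernel e δ w) {S : Set (E n)} {q : E n × E n → ℝ}
    {x : E n} (hx : MemLp (fun y => q (x, y)) 2 (volume.restrict S)) (v : E n) :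
    inner ℝ (fluxDensity (volume.restrict S) w q x) v =
      ∫ y in S, q (x, y) * (inner ℝ (x - y) v * w (x - y)) := by
  have hm := hw.measurable
  have hi : Integrable (fun y => (q (x, y) * w (x - y)) • (x - y)) (volume.restrict S) := by
    refine (hx.integrable_mul (hw.memLp_sub_left S x)).mono ?_ (ae_of_all _ fun y => ?_)
    · exact (hx.1.mul (Measurable.aestronglyMeasurable (by fun_prop))).smul
        (Measurable.aestronglyMeasurable (by fun_prop))
    · simp [norm_smul]
      exact le_of_eq (by ring)
  rw [fluxDensity, real_inner_comm, ← integral_inner hi]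
  refine integral_congr_ae (ae_of_all _ fun y => ?_)
  simp only [real_inner_smul_right]
  rw [real_inner_comm]; ring

/-- The flux density is pointwise controlled by the two-point flux. -/
theorem IsKernel.norm_fluxDensity_sq_le (hw : IsKernel e δ w) (he : ‖e‖ = 1) {S : Set (E n)}
    {q : E n × E n → ℝ} {x : E n} (hx : MemLp (fun y => q (x, y)) 2 (volume.restrict S)) :
    ‖fluxDensity (volume.restrict S) w q x‖ ^ 2 ≤ ∫ y in S, q (x, y) ^ 2 := by
  set P := fluxDensity (volume.restrict S) w q x with hP
  -- Testing in the direction `P` itself gives `‖P‖⁴ ≤ (∫ q²) ‖P‖²`, from which one factor `‖P‖²` is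
  -- cancelled.
  have h1 := hx.sq_integral_mul_le (hw.memLp_inner_sub_left S x P)
  rw [← hw.inner_fluxDensity hx P, ← hP, real_inner_self_eq_norm_sq] at h1
  have h2 : ∫ y in S, (inner ℝ (x - y) P * w (x - y)) ^ 2 ≤ ‖P‖ ^ 2 := by
    simp only [mul_pow]
    exact (integral_restrict_sub_left_le (hw.integrable_inner_sq P) (fun x => by positivity)
      S x).trans (hw.integral_inner_sq_le he P)
  have h0 : 0 ≤ ∫ y in S, q (x, y) ^ 2 := integral_nonneg fun _ => sq_nonneg _
  rcases eq_or_ne ‖P‖ 0 with h | h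
  · rw [h]; simpa using h0
  · have hp : 0 < ‖P‖ ^ 2 := by positivity
    have h3 := h1.trans (mul_le_mul_of_nonneg_left h2 h0)
    rw [pow_two (‖P‖ ^ 2)] at h3
    exact le_of_mul_le_mul_right h3 hp

theorem IsKernel.memLp_fluxDensity (hw : IsKernel e δ w) (he : ‖e‖ = 1) {S : Set (E n)}
    {q : E n × E n → ℝ} (hq : MemLp q 2 ((volume.restrict S).prod (volume.restrict S))) :
    MemLp (fluxDensity (volume.restrict S) w q) 2 (volume.restrict S) := by
  rw [memLp_two_iff_integrable_sq_norm (aestronglyMeasurable_fluxDensity hw.measurable hq.1)]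
  refine hq.integrable_sq.integral_prod_left.mono'
    ((aestronglyMeasurable_fluxDensity hw.measurable hq.1).norm.pow 2) ?_
  filter_upwards [ae_memLp_section hq] with x hx
  rw [Real.norm_of_nonneg (by positivity)]
  exact hw.norm_fluxDensity_sq_le he hx

end FluxDensity

/-! ### Comparison of nonlocal and distributional divergence. -/

section WeakDivergence

variable {n : ℕ} {e : E n} {δ : ℝ} {w : E n → ℝ}

/-- The derivative of a test function is globally Lipschitz; the mean value inequality on the ball
about `x` of radius `‖x - y‖` turns its Lipschitz constant into `L`. -/
theorem exists_abs_sub_sub_inner_gradient_le {φ : E n → ℝ} (hφ : ContDiff ℝ ∞ φ)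
    (hc : HasCompactSupport φ) :
    ∃ L : ℝ, 0 ≤ L ∧ ∀ x y, |φ x - φ y - inner ℝ (x - y) (gradient φ x)| ≤ L * ‖x - y‖ ^ 2 := by
  obtain ⟨C, hC⟩ := (hφ.fderiv_right (m := 1) (by exact WithTop.coe_le_coe.2 le_top)
    ).lipschitzWith_of_hasCompactSupport (hc.fderiv (𝕜 := ℝ)) one_ne_zero
  refine ⟨C, C.2, fun x y => ?_⟩
  have h := Convex.norm_image_sub_le_of_norm_hasFDerivWithin_le' (f := φ) (f' := fderiv ℝ φ)
    (φ := fderiv ℝ φ x) (s := Metric.closedBall x ‖x - y‖) (C := C * ‖x - y‖) (x := y) (y := x)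
    (fun z _ => ((hφ.differentiable (by simp)) z).hasFDerivAt.hasFDerivWithinAt)
    (fun z hz => by
      refine (hC.norm_sub_le z x).trans ?_
      rw [mem_closedBall_iff_norm] at hz
      gcongr)
    (convex_closedBall _ _) (by simp [dist_eq_norm, norm_sub_rev]) (by simp)
  rw [real_inner_comm, inner_gradient_left, ← Real.norm_eq_abs]
  refine h.trans (le_of_eq (by ring))

theorem continuous_gradient {φ : E n → ℝ} (hφ : ContDiff ℝ ∞ φ) : Continuous (gradient φ) :=
  (InnerProductSpace.toDual ℝ (E n)).symm.continuous.comp (hφ.continuous_fderiv (by simp))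

theorem support_gradient_subset_tsupport (φ : E n → ℝ) :
    Function.support (gradient φ) ⊆ tsupport φ := by
  intro x hx
  refine support_fderiv_subset ℝ (f := φ) ?_
  rw [Function.mem_support] at hx ⊢
  contrapose! hx
  simp [gradient, hx]

theorem hasCompactSupport_gradient {φ : E n → ℝ} (hc : HasCompactSupport φ) :
    HasCompactSupport (gradient φ) :=
  hc.mono' (support_gradient_subset_tsupport φ)

theorem IsKernel.memLp_difference (hw : IsKernel e δ w) {S : Set (E n)} (hS : volume S ≠ ⊤)
    {φ : E n → ℝ} (hφ : ContDiff ℝ ∞ φ) (hc : HasCompactSupport φ) :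
    MemLp (fun z : E n × E n => (φ z.1 - φ z.2) * w (z.1 - z.2)) 2
      ((volume.restrict S).prod (volume.restrict S)) := by
  have hm := hw.measurable
  have hm' := hφ.continuous.measurable
  obtain ⟨C, hC⟩ := hφ.lipschitzWith_of_hasCompactSupport hc (by simp)
  refine (hw.memLp_prod hS).1.of_le_mul (c := C) (Measurable.aestronglyMeasurable (by fun_prop))
    (ae_of_all _ fun z => ?_)
  rw [norm_mul, norm_mul, norm_norm, ← mul_assoc]
  gcongr
  exact hC.norm_sub_le _ _

theorem IsKernel.memLp_directional (hw : IsKernel e δ w) {S : Set (E n)} (hS : volume S ≠ ⊤)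
    {φ : E n → ℝ} (hφ : ContDiff ℝ ∞ φ) (hc : HasCompactSupport φ) :
    MemLp (fun z : E n × E n => inner ℝ (z.1 - z.2) (gradient φ z.1) * w (z.1 - z.2)) 2
      ((volume.restrict S).prod (volume.restrict S)) := by
  have hm := hw.measurable
  have hm' := (continuous_gradient hφ).measurable
  obtain ⟨C, hC⟩ := (continuous_gradient hφ).bounded_above_of_compact_support
    (hasCompactSupport_gradient hc)
  refine (hw.memLp_prod hS).1.of_le_mul (c := C) (Measurable.aestronglyMeasurable (by fun_prop))
    (ae_of_all _ fun z => ?_)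
  rw [norm_mul, norm_mul, norm_norm, ← mul_assoc]
  gcongr
  rw [mul_comm]
  refine (abs_real_inner_le_norm _ _).trans ?_
  gcongr
  exact hC _

/-- The distributional divergence of the flux density is close to the nonlocal divergence of the
two-point flux. -/
theorem IsKernel.sq_fluxDensity_sub_le (hw : IsKernel e δ w) {S : Set (E n)}
    (hS : volume S ≠ ⊤) {φ : E n → ℝ} (hφ : ContDiff ℝ ∞ φ) (hc : HasCompactSupport φ) {L : ℝ}
    (hL0 : 0 ≤ L)
    (hL : ∀ x y, |φ x - φ y - inner ℝ (x - y) (gradient φ x)| ≤ L * ‖x - y‖ ^ 2)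
    {q : E n × E n → ℝ} (hq : MemLp q 2 ((volume.restrict S).prod (volume.restrict S))) :
    ((∫ z, q z * ((φ z.1 - φ z.2) * w (z.1 - z.2))
        ∂((volume.restrict S).prod (volume.restrict S)))
      - ∫ x in S, inner ℝ (fluxDensity (volume.restrict S) w q x) (gradient φ x)) ^ 2 ≤
    (∫ z, q z ^ 2 ∂((volume.restrict S).prod (volume.restrict S))) *
      ((L * δ) ^ 2 * (volume.real S * (sphereMoment e)⁻¹)) := by
  have : IsFiniteMeasure (volume.restrict S) := ⟨by simpa using hS.lt_top⟩
  have ht := hw.memLp_difference hS hφ hc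
  have hs := hw.memLp_directional hS hφ hc
  have hk := hw.memLp_prod hS
  have it : Integrable (fun z : E n × E n => q z * ((φ z.1 - φ z.2) * w (z.1 - z.2)))
      ((volume.restrict S).prod (volume.restrict S)) := hq.integrable_mul ht
  have is : Integrable (fun z : E n × E n =>
      q z * (inner ℝ (z.1 - z.2) (gradient φ z.1) * w (z.1 - z.2)))
      ((volume.restrict S).prod (volume.restrict S)) := hq.integrable_mul hs
  have h1 : ∫ x in S, inner ℝ (fluxDensity (volume.restrict S) w q x) (gradient φ x) =
      ∫ z : E n × E n, q z * (inner ℝ (z.1 - z.2) (gradient φ z.1) * w (z.1 - z.2))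
        ∂((volume.restrict S).prod (volume.restrict S)) := by
    rw [integral_prod _ is]
    refine integral_congr_ae ?_
    filter_upwards [ae_memLp_section hq] with x hx
    exact hw.inner_fluxDensity hx _
  rw [h1, ← integral_sub it is]
  simp only [← mul_sub]
  refine (hq.sq_integral_mul_le (ht.sub hs)).trans ?_
  refine mul_le_mul_of_nonneg_left ?_ (integral_nonneg fun _ => sq_nonneg _)
  calc _ ≤ ∫ z : E n × E n, (L * δ) ^ 2 * (‖z.1 - z.2‖ * w (z.1 - z.2)) ^ 2
        ∂((volume.restrict S).prod (volume.restrict S)) := by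
        refine integral_mono (ht.sub hs).integrable_sq (hk.1.integrable_sq.const_mul _)
          fun z => ?_
        simp only [Pi.sub_apply]
        rw [← mul_pow, ← sub_mul, ← sq_abs, abs_mul, abs_of_nonneg (hw.nonneg _)]
        -- Where the kernel does not vanish, `‖x - y‖ < δ`, so one factor of the quadratic Taylor
        -- error becomes `δ` and the other is absorbed by the kernel.
        by_cases hz : w (z.1 - z.2) = 0
        · simp [hz]
        have hz' := hw.support_subset hz
        rw [mem_ball_zero_iff] at hz'
        have := hw.nonneg (z.1 - z.2)
        have h3 : L * ‖z.1 - z.2‖ ^ 2 ≤ L * δ * ‖z.1 - z.2‖ := by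
          rw [pow_two, ← mul_assoc]
          gcongr
        rw [← mul_assoc]
        gcongr
        exact (hL _ _).trans h3
    _ ≤ _ := by
        rw [integral_const_mul]
        exact mul_le_mul_of_nonneg_left hk.2 (sq_nonneg _)

end WeakDivergence

/-! ### Antisymmetrization and the weighted energy. -/

section Energy

variable {n : ℕ} {e : E n} {δ : ℝ} {w : E n → ℝ}

/-- The antisymmetric part of a two-point flux. -/
noncomputable def antisymmPart (q : E n × E n → ℝ) (z : E n × E n) : ℝ := (q z - q z.swap) / 2

theorem memLp_comp_swap {μ : Measure (E n)} [SFinite μ] {q : E n × E n → ℝ}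
    (hq : MemLp q 2 (μ.prod μ)) : MemLp (fun z => q z.swap) 2 (μ.prod μ) :=
  hq.comp_measurePreserving Measure.measurePreserving_swap

theorem memLp_antisymmPart {μ : Measure (E n)} [SFinite μ] {q : E n × E n → ℝ}
    (hq : MemLp q 2 (μ.prod μ)) : MemLp (antisymmPart q) 2 (μ.prod μ) := by
  have h := (hq.sub (memLp_comp_swap hq)).const_mul (2⁻¹ : ℝ)
  refine h.ae_eq (ae_of_all _ fun z => ?_)
  simp [antisymmPart]; ring

theorem antisymmPart_sq_le (q : E n × E n → ℝ) (z : E n × E n) :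
    antisymmPart q z ^ 2 ≤ (q z ^ 2 + q z.swap ^ 2) / 2 := by
  unfold antisymmPart
  nlinarith [sq_nonneg (q z + q z.swap)]

/-- Symmetric fluxes are orthogonal to antisymmetric functions. Nonlocal gradients are
antisymmetric, so passing to `antisymmPart` leaves the divergence unchanged. -/
theorem integral_antisymmPart_mul {μ : Measure (E n)} [SFinite μ] {q g : E n × E n → ℝ}
    (hq : MemLp q 2 (μ.prod μ)) (hg : MemLp g 2 (μ.prod μ)) (hanti : ∀ z, g z.swap = -g z) :
    ∫ z, antisymmPart q z * g z ∂(μ.prod μ) = ∫ z, q z * g z ∂(μ.prod μ) := by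
  have h1 : ∀ z, antisymmPart q z * g z = (q z * g z + q z.swap * g z.swap) / 2 := fun z => by
    rw [hanti]; unfold antisymmPart; ring
  have hi : Integrable (fun z => q z * g z) (μ.prod μ) := hq.integrable_mul hg
  have hi' : Integrable (fun z => q z.swap * g z.swap) (μ.prod μ) := hi.swap
  simp only [h1]
  rw [integral_div, integral_add hi hi', integral_prod_swap
    (fun z => q z * g z)]
  ring

theorem integrable_weight_fst {μ : Measure (E n)} [SFinite μ] {c : E n → ℝ} {C : ℝ}
    (hcm : AEStronglyMeasurable c μ) (hc : ∀ᵐ x ∂μ, ‖c x‖ ≤ C) {g : E n × E n → ℝ}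
    (hg : Integrable g (μ.prod μ)) : Integrable (fun z => c z.1 * g z) (μ.prod μ) :=
  hg.bdd_mul (c := C) hcm.comp_fst (Measure.quasiMeasurePreserving_fst.ae hc)

/-- The weighted energy of the flux density of the antisymmetric part of a two-point flux. -/
theorem IsKernel.integral_weight_fluxDensity_le (hw : IsKernel e δ w) (he : ‖e‖ = 1)
    {S : Set (E n)} {q : E n × E n → ℝ}
    (hq : MemLp q 2 ((volume.restrict S).prod (volume.restrict S)))
    {c : E n → ℝ} {C : ℝ} (hcm : AEStronglyMeasurable c (volume.restrict S))
    (hc : ∀ᵐ x ∂volume.restrict S, c x ∈ Set.Icc 0 C) :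
    ∫ x in S, c x * ‖fluxDensity (volume.restrict S) w (antisymmPart q) x‖ ^ 2 ≤
      ∫ z, (c z.1 + c z.2) / 2 * q z ^ 2 ∂((volume.restrict S).prod (volume.restrict S)) := by
  set μ := volume.restrict S with hμ
  have hcC : ∀ᵐ x ∂μ, ‖c x‖ ≤ C := by
    filter_upwards [hc] with x hx
    rw [Real.norm_of_nonneg hx.1]; exact hx.2
  have ha := memLp_antisymmPart hq
  have hs := memLp_comp_swap hq
  have i1 := integrable_weight_fst hcm hcC ha.integrable_sq
  have i2 := integrable_weight_fst hcm hcC hq.integrable_sq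
  have i3 := integrable_weight_fst hcm hcC hs.integrable_sq
  have hP := hw.memLp_fluxDensity he ha
  calc ∫ x, c x * ‖fluxDensity μ w (antisymmPart q) x‖ ^ 2 ∂μ
      ≤ ∫ x, ∫ y, c x * antisymmPart q (x, y) ^ 2 ∂μ ∂μ := by
        refine integral_mono_ae (hP.integrable_norm_pow (by simp) |>.bdd_mul hcm hcC)
          i1.integral_prod_left ?_
        filter_upwards [ae_memLp_section ha, hc] with x hx hcx
        rw [integral_const_mul]
        exact mul_le_mul_of_nonneg_left (hw.norm_fluxDensity_sq_le he hx) hcx.1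
    _ = ∫ z, c z.1 * antisymmPart q z ^ 2 ∂(μ.prod μ) := (integral_prod _ i1).symm
    _ ≤ ∫ z, (c z.1 * q z ^ 2 + c z.1 * q z.swap ^ 2) / 2 ∂(μ.prod μ) := by
        refine integral_mono_ae i1 ((i2.add i3).div_const 2) ?_
        filter_upwards [Measure.quasiMeasurePreserving_fst.ae hc] with z hz
        calc c z.1 * antisymmPart q z ^ 2 ≤ c z.1 * ((q z ^ 2 + q z.swap ^ 2) / 2) :=
              mul_le_mul_of_nonneg_left (antisymmPart_sq_le q z) hz.1
          _ = _ := by ring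
    -- Swapping the variables in the second term moves its weight from `x` to `y`.
    _ = ∫ z, (c z.1 + c z.2) / 2 * q z ^ 2 ∂(μ.prod μ) := by
        have h4 : ∫ z, c z.1 * q z.swap ^ 2 ∂(μ.prod μ) = ∫ z, c z.2 * q z ^ 2 ∂(μ.prod μ) := by
          rw [← integral_prod_swap (fun z => c z.2 * q z ^ 2)]
          rfl
        have i4 : Integrable (fun z => c z.2 * q z ^ 2) (μ.prod μ) := by
          have := Integrable.swap i3
          simpa [Function.comp_def] using this
        rw [integral_div, integral_add i2 i3, h4, ← integral_add i2 i4, ← integral_div]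
        exact integral_congr_ae (ae_of_all _ fun z => by simp only; ring)

end Energy

/-! ### From a nonlocal design to a local one. -/

section LocalFlux

variable {n : ℕ} {e : E n} {δ : ℝ} {w : E n → ℝ} {Ω : Set (E n)} {kmin kmax γ : ℝ}

theorem pairMeasure_eq_prod (Ω : Set (E n)) (δ : ℝ) :
    pairMeasure Ω δ = (volume.restrict (Metric.thickening δ Ω)).prod
      (volume.restrict (Metric.thickening δ Ω)) := by
  rw [pairMeasure, Measure.prod_restrict, Measure.volume_eq_prod]

theorem NonlocalConductivities.ae_mem_Icc {κ : E n → ℝ} (hδ : 0 < δ)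
    (hκ : κ ∈ NonlocalConductivities Ω kmin kmax γ δ) :
    ∀ᵐ x ∂volume.restrict (Metric.thickening δ Ω), κ x ∈ Set.Icc kmin kmax := by
  obtain ⟨-, ⟨-, h1, -⟩, h2⟩ := hκ
  rw [← Set.union_sdiff_cancel (Metric.self_subset_thickening hδ Ω), ae_restrict_union_iff]
  exact ⟨h1, h2⟩

/-- This is where the choice of the harmonic average enters: its reciprocal is the weight in
`IsKernel.integral_weight_fluxDensity_le` for `c = κ⁻¹`. -/
theorem inv_harmonicAvg {κ : E n → ℝ} {z : E n × E n} (h1 : 0 < κ z.1) (h2 : 0 < κ z.2) :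
    (harmonicAvg κ z)⁻¹ = ((κ z.1)⁻¹ + (κ z.2)⁻¹) / 2 := by
  unfold harmonicAvg
  field_simp
  ring

theorem integral_antisymmPart_sq_le {μ : Measure (E n)} [SFinite μ] {q : E n × E n → ℝ}
    (hq : MemLp q 2 (μ.prod μ)) :
    ∫ z, antisymmPart q z ^ 2 ∂(μ.prod μ) ≤ ∫ z, q z ^ 2 ∂(μ.prod μ) := by
  have i1 := hq.integrable_sq
  have i2 := (memLp_comp_swap hq).integrable_sq
  calc _ ≤ ∫ z, (q z ^ 2 + q z.swap ^ 2) / 2 ∂(μ.prod μ) :=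
        integral_mono (memLp_antisymmPart hq).integrable_sq ((i1.add i2).div_const 2)
          (antisymmPart_sq_le q)
    _ = _ := by
        rw [integral_div, integral_add i1 i2, integral_prod_swap (fun z => q z ^ 2)]
        ring

/-- Every admissible nonlocal design yields a vector field of no larger local energy that almost
has the right divergence. -/
theorem IsKernel.exists_local_flux (hw : IsKernel e δ w) (he : ‖e‖ = 1)
    (hb : Bornology.IsBounded Ω) (hkmin : 0 < kmin) (hk : kmin < kmax) (hδ : 0 < δ)
    (hδ1 : δ ≤ 1) {f : E n → ℝ} {κ : E n → ℝ} {q : E n × E n → ℝ}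
    (hκ : κ ∈ NonlocalConductivities Ω kmin kmax γ δ) (hq : q ∈ NonlocalFluxes Ω δ w f) :
    ∃ p : E n → E n, MemLp p 2 (volume.restrict Ω) ∧
      localEnergy Ω κ p ≤ nonlocalEnergy Ω δ κ q ∧
      ∀ (φ : E n → ℝ) (L : ℝ), ContDiff ℝ ∞ φ → HasCompactSupport φ → tsupport φ ⊆ Ω → 0 ≤ L →
        (∀ x y, |φ x - φ y - inner ℝ (x - y) (gradient φ x)| ≤ L * ‖x - y‖ ^ 2) →
        ((∫ x in Ω, f x * φ x) + ∫ x in Ω, inner ℝ (p x) (gradient φ x)) ^ 2 ≤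
          2 * kmax * nonlocalEnergy Ω δ κ q *
            ((L * δ) ^ 2 * (volume.real (Metric.thickening 1 Ω) * (sphereMoment e)⁻¹)) := by
  obtain ⟨⟨hq2, -⟩, hdiv⟩ := hq
  have hae := NonlocalConductivities.ae_mem_Icc hδ hκ
  have hκm : AEStronglyMeasurable κ (volume.restrict (Metric.thickening δ Ω)) := hκ.1.1
  have hΩS := Metric.self_subset_thickening hδ Ω
  have hS1 : volume (Metric.thickening 1 Ω) ≠ ⊤ := (hb.thickening (δ := 1)).measure_lt_top.ne
  have hS : volume (Metric.thickening δ Ω) ≠ ⊤ := (hb.thickening (δ := δ)).measure_lt_top.ne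
  have hSreal : volume.real (Metric.thickening δ Ω) ≤ volume.real (Metric.thickening 1 Ω) :=
    measureReal_mono (Metric.thickening_mono hδ1 Ω) hS1
  have hK0 : 0 ≤ (sphereMoment e)⁻¹ := by
    rw [← hw.normalized]; exact integral_nonneg fun x => by positivity
  unfold nonlocalEnergy
  unfold IsNonlocalDiv at hdiv
  have hG : ∀ v, MemLp v 2 (volume.restrict Ω) →
      MemLp (nonlocalGrad Ω w v) 2 (pairMeasure Ω δ) → v ∈ GradDomain Ω δ w :=
    fun v h1 h2 => ⟨h1, h2⟩
  simp only [pairMeasure_eq_prod] at hq2 hdiv hG ⊢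
  set S := Metric.thickening δ Ω with hSdef
  have hqa := memLp_antisymmPart hq2
  have hc : ∀ᵐ x ∂volume.restrict S, (κ x)⁻¹ ∈ Set.Icc 0 kmin⁻¹ := by
    filter_upwards [hae] with x hx
    exact ⟨inv_nonneg.2 (hkmin.le.trans hx.1), inv_anti₀ hkmin hx.1⟩
  have hcm : AEStronglyMeasurable (fun x => (κ x)⁻¹) (volume.restrict S) :=
    hκm.aemeasurable.inv.aestronglyMeasurable
  have hcC : ∀ᵐ x ∂volume.restrict S, ‖(κ x)⁻¹‖ ≤ kmin⁻¹ := by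
    filter_upwards [hc] with x hx
    rw [Real.norm_of_nonneg hx.1]; exact hx.2
  have hharm : ∫ z, (harmonicAvg κ z)⁻¹ * q z ^ 2 ∂((volume.restrict S).prod (volume.restrict S))
      = ∫ z, ((κ z.1)⁻¹ + (κ z.2)⁻¹) / 2 * q z ^ 2
          ∂((volume.restrict S).prod (volume.restrict S)) := by
    refine integral_congr_ae ?_
    filter_upwards [Measure.quasiMeasurePreserving_fst.ae hae,
      Measure.quasiMeasurePreserving_snd.ae hae] with z h1 h2
    rw [inv_harmonicAvg (hkmin.trans_le h1.1) (hkmin.trans_le h2.1)]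
  -- Source of the factor `2 * kmax` in the error estimate: `κ⁻¹ ≥ kmax⁻¹`, and the energy carries a
  -- factor `1 / 2`.
  have hqE : ∫ z, q z ^ 2 ∂((volume.restrict S).prod (volume.restrict S)) ≤
      kmax * ∫ z, (harmonicAvg κ z)⁻¹ * q z ^ 2
        ∂((volume.restrict S).prod (volume.restrict S)) := by
    rw [hharm, ← integral_const_mul]
    refine integral_mono_ae hq2.integrable_sq (Integrable.const_mul ?_ _) ?_
    · refine hq2.integrable_sq.bdd_mul (c := kmin⁻¹)
        (((hcm.comp_fst).add (hcm.comp_snd)).mul_const 2⁻¹) ?_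
      filter_upwards [Measure.quasiMeasurePreserving_fst.ae hc,
        Measure.quasiMeasurePreserving_snd.ae hc] with z h1 h2
      have := h1.1; have := h1.2; have := h2.1; have := h2.2
      rw [Real.norm_of_nonneg (by linarith)]
      linarith
    · filter_upwards [Measure.quasiMeasurePreserving_fst.ae hae,
        Measure.quasiMeasurePreserving_snd.ae hae] with z h1 h2
      have hkx : 0 < kmax := hkmin.trans hk
      have e1 : kmax⁻¹ ≤ (κ z.1)⁻¹ := inv_anti₀ (hkmin.trans_le h1.1) h1.2
      have e2 : kmax⁻¹ ≤ (κ z.2)⁻¹ := inv_anti₀ (hkmin.trans_le h2.1) h2.2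
      rw [← mul_assoc]
      refine le_mul_of_one_le_left (sq_nonneg _) ?_
      calc (1 : ℝ) = kmax * kmax⁻¹ := (mul_inv_cancel₀ hkx.ne').symm
        _ ≤ _ := by gcongr; linarith
  have hP := hw.memLp_fluxDensity he hqa
  refine ⟨fluxDensity (volume.restrict S) w (antisymmPart q),
    hP.mono_measure (Measure.restrict_mono hΩS le_rfl), ?_, ?_⟩
  · unfold localEnergy
    rw [hharm]
    refine mul_le_mul_of_nonneg_left ?_ (by norm_num)
    refine le_trans ?_ (hw.integral_weight_fluxDensity_le he hq2 hcm hc)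
    -- The energy density is nonnegative, so the part outside `Ω` can be dropped.
    refine setIntegral_mono_set ((hP.integrable_norm_pow (by simp)).bdd_mul hcm hcC) ?_
      (ae_of_all _ hΩS)
    filter_upwards [hc] with x hx
    exact mul_nonneg hx.1 (sq_nonneg _)
  · intro φ L hφ hcs hts hL0 hL
    have hind : Ω.indicator φ = φ :=
      Set.indicator_eq_self.2 ((subset_tsupport φ).trans hts)
    have hgr : nonlocalGrad Ω w φ = fun z => (φ z.1 - φ z.2) * w (z.1 - z.2) := by
      funext z; simp [nonlocalGrad, hind]
    have ht := hw.memLp_difference hS hφ hcs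
    have h1 := hdiv φ (hG φ (hφ.continuous.memLp_of_hasCompactSupport hcs) (by rwa [hgr]))
    rw [hgr, ← integral_antisymmPart_mul hq2 ht (fun z => by
      rw [hw.radial _ (z.1 - z.2) (by simp [norm_sub_rev])]
      simp only [Prod.fst_swap, Prod.snd_swap]; ring)] at h1
    have h2 := hw.sq_fluxDensity_sub_le hS hφ hcs hL0 hL hqa
    have h3 : ∫ x in Ω, inner ℝ (fluxDensity (volume.restrict S) w (antisymmPart q) x)
          (gradient φ x) =
        ∫ x in S, inner ℝ (fluxDensity (volume.restrict S) w (antisymmPart q) x)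
          (gradient φ x) := by
      refine (setIntegral_eq_of_subset_of_forall_sdiff_eq_zero
        (Metric.isOpen_thickening.measurableSet) hΩS fun x hx => ?_).symm
      have : gradient φ x = 0 := by
        by_contra h
        exact hx.2 (hts (support_gradient_subset_tsupport φ h))
      simp [this]
    rw [h1, h3]
    refine le_trans (le_of_eq (by ring)) (h2.trans ?_)
    have h4 : ∫ z, antisymmPart q z ^ 2 ∂((volume.restrict S).prod (volume.restrict S)) ≤
        2 * kmax * (1 / 2 * ∫ z, (harmonicAvg κ z)⁻¹ * q z ^ 2
          ∂((volume.restrict S).prod (volume.restrict S))) := by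
      linarith [integral_antisymmPart_sq_le hq2]
    refine mul_le_mul h4 (by gcongr) (by positivity) (le_trans ?_ h4)
    exact integral_nonneg fun _ => sq_nonneg _

end LocalFlux

/-! ### Weak limits and lower semicontinuity. -/

section Limit

/-- Expand `k⁻¹ ‖p - k a‖² ≥ 0`. Equality holds for `a = k⁻¹ p`, and the left side is affine in `(k,
p)`, hence compatible with weak limits. -/
theorem two_inner_sub_le_inv_mul {F : Type*} [NormedAddCommGroup F]
    [InnerProductSpace ℝ F] {k : ℝ} (hk : 0 < k) (p a : F) :
    2 * inner ℝ p a - k * ‖a‖ ^ 2 ≤ k⁻¹ * ‖p‖ ^ 2 := by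
  have h : 0 ≤ k⁻¹ * ‖p - k • a‖ ^ 2 := by positivity
  rw [norm_sub_sq_real, real_inner_smul_right, norm_smul, mul_pow, Real.norm_eq_abs, sq_abs] at h
  have h2 : k⁻¹ * (‖p‖ ^ 2 - 2 * (k * inner ℝ p a) + k ^ 2 * ‖a‖ ^ 2) =
      k⁻¹ * ‖p‖ ^ 2 - (2 * inner ℝ p a - k * ‖a‖ ^ 2) := by
    field_simp
    ring
  linarith

variable {α F : Type*} [MeasurableSpace α] {μ : Measure α} [IsFiniteMeasure μ]
  [NormedAddCommGroup F] [InnerProductSpace ℝ F] [CompleteSpace F]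

/-- Weak compactness and lower semicontinuity for the energy `∫ κ⁻¹ ‖p‖²`. -/
theorem exists_weak_limit {ι : Type*} (U : Ultrafilter ι) {kmin kmax m M : ℝ}
    (hkmin : 0 < kmin) (hk : kmin < kmax)
    (κ : ι → α → ℝ) (p : ι → α → F) (hκm : ∀ i, AEStronglyMeasurable (κ i) μ)
    (hκ : ∀ i, ∀ᵐ x ∂μ, κ i x ∈ Set.Icc kmin kmax) (hκγ : ∀ i, ∫ x, κ i x ∂μ ≤ m)
    (hp : ∀ i, MemLp (p i) 2 μ) (hM : ∀ i, ∫ x, (κ i x)⁻¹ * ‖p i x‖ ^ 2 ∂μ ≤ M) :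
    ∃ (κ₀ : α → ℝ) (p₀ : α → F), AEStronglyMeasurable κ₀ μ ∧
      (∀ᵐ x ∂μ, κ₀ x ∈ Set.Icc kmin kmax) ∧ ∫ x, κ₀ x ∂μ ≤ m ∧ MemLp p₀ 2 μ ∧
      ∫ x, (κ₀ x)⁻¹ * ‖p₀ x‖ ^ 2 ∂μ ≤ M ∧ ∀ v : α → F, MemLp v 2 μ →
      Tendsto (fun i => ∫ x, inner ℝ (p i x) (v x) ∂μ) U (𝓝 (∫ x, inner ℝ (p₀ x) (v x) ∂μ)) := by
  have hkmax : 0 < kmax := hkmin.trans hk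
  have inv_int : ∀ (k : α → ℝ) (r : α → F), AEStronglyMeasurable k μ →
      (∀ᵐ x ∂μ, k x ∈ Set.Icc kmin kmax) → MemLp r 2 μ →
      Integrable (fun x => (k x)⁻¹ * ‖r x‖ ^ 2) μ := by
    intro k r hkm hkb hr
    refine (hr.integrable_norm_pow (by simp)).bdd_mul (c := kmin⁻¹)
      hkm.aemeasurable.inv.aestronglyMeasurable ?_
    filter_upwards [hkb] with x hx
    rw [Real.norm_of_nonneg (inv_nonneg.2 (hkmin.le.trans hx.1))]
    exact inv_anti₀ hkmin hx.1
  have memB : ∀ (k : α → ℝ) (C : ℝ), AEStronglyMeasurable k μ → (∀ᵐ x ∂μ, ‖k x‖ ≤ C) →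
      MemLp k 2 μ := fun k C h1 h2 => MemLp.of_bound h1 C h2
  have normb : ∀ k : α → ℝ, (∀ᵐ x ∂μ, k x ∈ Set.Icc kmin kmax) → ∀ᵐ x ∂μ, ‖k x‖ ≤ kmax := by
    intro k h
    filter_upwards [h] with x hx
    rw [Real.norm_of_nonneg (hkmin.le.trans hx.1)]
    exact hx.2
  have hκ2 : ∀ i, MemLp (κ i) 2 μ := fun i => memB _ _ (hκm i) (normb _ (hκ i))
  have hpb : ∀ i, ∫ x, ‖p i x‖ ^ 2 ∂μ ≤ kmax * M := by
    intro i
    refine le_trans ?_ (mul_le_mul_of_nonneg_left (hM i) hkmax.le)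
    rw [← integral_const_mul]
    refine integral_mono_ae ((hp i).integrable_norm_pow (by simp))
      ((inv_int _ _ (hκm i) (hκ i) (hp i)).const_mul _) ?_
    filter_upwards [hκ i] with x hx
    have e1 : kmax⁻¹ ≤ (κ i x)⁻¹ := inv_anti₀ (hkmin.trans_le hx.1) hx.2
    rw [← mul_assoc]
    refine le_mul_of_one_le_left (sq_nonneg _) ?_
    calc (1 : ℝ) = kmax * kmax⁻¹ := (mul_inv_cancel₀ hkmax.ne').symm
      _ ≤ _ := by gcongr
  have hκb : ∀ i, ∫ x, ‖κ i x‖ ^ 2 ∂μ ≤ ∫ _, kmax ^ 2 ∂μ := by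
    intro i
    refine integral_mono_ae ((hκ2 i).integrable_norm_pow (by simp)) (integrable_const _) ?_
    filter_upwards [normb _ (hκ i)] with x hx
    gcongr
  obtain ⟨p₀, hp₀, hpt⟩ := exists_memLp_tendsto_integral_inner U p hp _ (Eventually.of_forall hpb)
  obtain ⟨κ₀, hκ₀, hκt'⟩ :=
    exists_memLp_tendsto_integral_inner U κ hκ2 _ (Eventually.of_forall hκb)
  have hκt : ∀ v : α → ℝ, MemLp v 2 μ →
      Tendsto (fun i => ∫ x, κ i x * v x ∂μ) U (𝓝 (∫ x, κ₀ x * v x ∂μ)) := by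
    intro v hv
    have := hκt' v hv
    simpa [mul_comm] using this
  -- Testing with indicators: the pointwise bounds and the mean constraint are inequalities between
  -- integrals over sets, which pass to the weak limit.
  have hset : ∀ s, MeasurableSet s →
      Tendsto (fun i => ∫ x in s, κ i x ∂μ) U (𝓝 (∫ x in s, κ₀ x ∂μ)) := by
    intro s hs
    have h := hκt (s.indicator fun _ => 1) (memLp_indicator_const 2 hs 1 (Or.inr (measure_ne_top _ _)))
    have e : ∀ k : α → ℝ, ∫ x, k x * s.indicator (fun _ => (1 : ℝ)) x ∂μ = ∫ x in s, k x ∂μ := by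
      intro k
      rw [← integral_indicator hs]
      refine integral_congr_ae (ae_of_all _ fun x => ?_)
      by_cases hx : x ∈ s <;> simp [hx]
    simpa only [e] using h
  have i0 : Integrable κ₀ μ := hκ₀.integrable (by norm_num)
  have ii : ∀ i, Integrable (κ i) μ := fun i => (hκ2 i).integrable (by norm_num)
  have hlow : ∀ᵐ x ∂μ, kmin ≤ κ₀ x := by
    refine ae_le_of_forall_setIntegral_le (integrable_const kmin) i0 fun s hs _ => ?_
    refine ge_of_tendsto' (hset s hs) fun i => ?_
    refine setIntegral_mono_ae (integrable_const kmin).integrableOn (ii i).integrableOn ?_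
    filter_upwards [hκ i] with x hx using hx.1
  have hup : ∀ᵐ x ∂μ, κ₀ x ≤ kmax := by
    refine ae_le_of_forall_setIntegral_le i0 (integrable_const kmax) fun s hs _ => ?_
    refine le_of_tendsto' (hset s hs) fun i => ?_
    refine setIntegral_mono_ae (ii i).integrableOn (integrable_const kmax).integrableOn ?_
    filter_upwards [hκ i] with x hx using hx.2
  have hκ₀b : ∀ᵐ x ∂μ, κ₀ x ∈ Set.Icc kmin kmax := by
    filter_upwards [hlow, hup] with x h1 h2 using ⟨h1, h2⟩
  refine ⟨κ₀, p₀, hκ₀.1, hκ₀b, ?_, hp₀, ?_, hpt⟩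
  · have h := hset Set.univ MeasurableSet.univ
    simp only [Measure.restrict_univ] at h
    exact le_of_tendsto' h hκγ
  -- a bounded test field gives a lower bound for the energies
  have hbound : ∀ a : α → F, AEStronglyMeasurable a μ → ∀ N : ℝ, (∀ᵐ x ∂μ, ‖a x‖ ≤ N) →
      ∫ x, (2 * inner ℝ (p₀ x) (a x) - κ₀ x * ‖a x‖ ^ 2) ∂μ ≤ M := by
    intro a ham N haN
    have ha : MemLp a 2 μ := MemLp.of_bound ham N haN
    have ha2 : MemLp (fun x => ‖a x‖ ^ 2) 2 μ := by
      refine MemLp.of_bound (ham.norm.pow 2) (N ^ 2) ?_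
      filter_upwards [haN] with x hx
      rw [norm_pow, norm_norm]
      gcongr
    have split : ∀ (k : α → ℝ) (r : α → F), MemLp k 2 μ → MemLp r 2 μ →
        Integrable (fun x => 2 * inner ℝ (r x) (a x) - k x * ‖a x‖ ^ 2) μ ∧
        ∫ x, (2 * inner ℝ (r x) (a x) - k x * ‖a x‖ ^ 2) ∂μ =
          2 * ∫ x, inner ℝ (r x) (a x) ∂μ - ∫ x, k x * ‖a x‖ ^ 2 ∂μ := by
      intro k r hk' hr
      have j1 : Integrable (fun x => 2 * inner ℝ (r x) (a x)) μ :=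
        (hr.integrable_inner_of_two ha).const_mul 2
      have j2 : Integrable (fun x => k x * ‖a x‖ ^ 2) μ := hk'.integrable_mul ha2
      exact ⟨j1.sub j2, by rw [integral_sub j1 j2, integral_const_mul]⟩
    rw [(split κ₀ p₀ hκ₀ hp₀).2]
    refine le_of_tendsto' (((hpt a ha).const_mul 2).sub (hκt _ ha2)) fun i => ?_
    rw [← (split (κ i) (p i) (hκ2 i) (hp i)).2]
    refine le_trans (integral_mono_ae (split (κ i) (p i) (hκ2 i) (hp i)).1
      (inv_int _ _ (hκm i) (hκ i) (hp i)) ?_) (hM i)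
    filter_upwards [hκ i] with x hx
    exact two_inner_sub_le_inv_mul (hkmin.trans_le hx.1) _ _
  -- The optimal field `κ₀⁻¹ p₀` need not be bounded, so it is cut off to the set `A N` where its
  -- norm is at most `N`. There the bound reads `∫ κ₀⁻¹ ‖p₀‖² ≤ M`, and `N → ∞` by exhaustion.
  -- Strongly measurable representatives make `A N` measurable.
  obtain ⟨p₁, hp₁m, hp₁⟩ := hp₀.1
  obtain ⟨κ₁, hκ₁m, hκ₁⟩ := hκ₀.1
  let A : ℕ → Set α := fun N => {x | ‖(κ₁ x)⁻¹ • p₁ x‖ ≤ N}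
  have ham : StronglyMeasurable fun x => (κ₁ x)⁻¹ • p₁ x :=
    hκ₁m.measurable.inv.stronglyMeasurable.smul hp₁m
  have hA : ∀ N, MeasurableSet (A N) := fun N =>
    measurableSet_le ham.norm.measurable measurable_const
  have hAmono : Monotone A := fun N N' h x hx => by
    simp only [A, Set.mem_ofPred_eq] at hx ⊢
    exact hx.trans (Nat.cast_le.2 h)
  have hAu : ⋃ N, A N = Set.univ := Set.eq_univ_of_forall fun x =>
    Set.mem_iUnion.2 (exists_nat_ge ‖(κ₁ x)⁻¹ • p₁ x‖)
  have hlim := tendsto_setIntegral_of_monotone hA hAmono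
    (inv_int κ₀ p₀ hκ₀.1 hκ₀b hp₀).integrableOn
  rw [hAu, Measure.restrict_univ] at hlim
  refine le_of_tendsto' hlim fun N => ?_
  refine le_trans (le_of_eq ?_) (hbound ((A N).indicator fun x => (κ₁ x)⁻¹ • p₁ x)
    (ham.indicator (hA N)).aestronglyMeasurable N (ae_of_all _ fun x => ?_))
  · rw [← integral_indicator (hA N)]
    refine integral_congr_ae ?_
    filter_upwards [hκ₁, hp₁, hκ₀b] with x h1 h2 h3
    by_cases hx : x ∈ A N
    · have : κ₁ x ≠ 0 := by rw [← h1]; exact (hkmin.trans_le h3.1).ne'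
      simp only [Set.indicator_of_mem hx, h1, h2, real_inner_smul_right,
        real_inner_self_eq_norm_sq, norm_smul, mul_pow, norm_inv, Real.norm_eq_abs, inv_pow, sq_abs]
      field_simp
      ring
    · simp [Set.indicator_of_notMem hx]
  · by_cases hx : x ∈ A N
    · rw [Set.indicator_of_mem hx]; exact hx
    · rw [Set.indicator_of_notMem hx]; simp

end Limit

/-- If the nonlocal dual values lie below `M` for arbitrarily small horizons, then so does the
local dual value. -/
theorem localDualValue_le_of_frequently {n : ℕ} {Ω : Set (E n)}
    (hΩb : Bornology.IsBounded Ω) {kmin kmax γ : ℝ} (hkmin : 0 < kmin) (hk : kmin < kmax)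
    {f : E n → ℝ} (hf : MemLp f 2 (volume.restrict Ω)) {e : E n} (he : ‖e‖ = 1)
    {w : ℝ → E n → ℝ} (hw : ∀ δ : ℝ, 0 < δ → IsKernel e δ (w δ)) {M : ℝ}
    (h : ∃ᶠ δ in 𝓝[>] (0 : ℝ), nonlocalDualValue Ω kmin kmax γ f δ (w δ) < (M : EReal)) :
    localDualValue Ω kmin kmax γ f ≤ (M : EReal) := by
  have : IsFiniteMeasure (volume.restrict Ω) := ⟨by simpa using hΩb.measure_lt_top⟩
  set C := 2 * kmax * M with hC
  set D := volume.real (Metric.thickening 1 Ω) * (sphereMoment e)⁻¹ with hD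
  have hD0 : 0 ≤ D := by
    refine mul_nonneg measureReal_nonneg ?_
    rw [← (hw 1 one_pos).normalized]
    exact integral_nonneg fun x => by positivity
  let Good : ℝ → (E n → ℝ) × (E n → E n) → Prop := fun δ r =>
    r.1 ∈ Conductivities Ω kmin kmax γ ∧ MemLp r.2 2 (volume.restrict Ω) ∧
      localEnergy Ω r.1 r.2 ≤ M ∧
      ∀ (φ : E n → ℝ) (L : ℝ), ContDiff ℝ ∞ φ → HasCompactSupport φ → tsupport φ ⊆ Ω → 0 ≤ L →
        (∀ x y, |φ x - φ y - inner ℝ (x - y) (gradient φ x)| ≤ L * ‖x - y‖ ^ 2) →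
        ((∫ x in Ω, f x * φ x) + ∫ x in Ω, inner ℝ (r.2 x) (gradient φ x)) ^ 2 ≤
          C * ((L * δ) ^ 2 * D)
  have hgood : ∃ᶠ δ in 𝓝[>] (0 : ℝ), ∃ r, Good δ r := by
    have hsmall : ∀ᶠ δ in 𝓝[>] (0 : ℝ), 0 < δ ∧ δ ≤ 1 :=
      Ioc_mem_nhdsGT one_pos
    refine (h.and_eventually hsmall).mono fun δ ⟨hlt, hδ, hδ1⟩ => ?_
    -- An infimum strictly below `M` supplies an admissible pair, so no minimizer is required.
    simp only [nonlocalDualValue, iInf_lt_iff] at hlt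
    obtain ⟨κ, hκ, q, hq, hE⟩ := hlt
    have hE' : nonlocalEnergy Ω δ κ q ≤ M := (EReal.coe_lt_coe_iff.1 hE).le
    obtain ⟨p, hp, hpe, hpd⟩ := (hw δ hδ).exists_local_flux he hΩb hkmin hk hδ hδ1 hκ hq
    refine ⟨(κ, p), hκ.2.1, hp, hpe.trans hE', fun φ L h1 h2 h3 h4 h5 => ?_⟩
    refine (hpd φ L h1 h2 h3 h4 h5).trans ?_
    have : 0 < kmax := hkmin.trans hk
    exact mul_le_mul_of_nonneg_right (by rw [hC]; gcongr) (by positivity)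
  let S : Set ℝ := {δ | ∃ r, Good δ r}
  have hne : (𝓝[>] (0 : ℝ) ⊓ 𝓟 S).NeBot := frequently_mem_iff_neBot.1 hgood
  obtain ⟨δ₀, r₀, hr₀⟩ := hgood.exists
  -- The compactness lemma wants its bounds for every index, so horizons outside `S` receive the
  -- fixed pair `r₀`. The ultrafilter contains `S` and never sees this default.
  have hex : ∀ δ, ∃ r : (E n → ℝ) × (E n → E n), (r.1 ∈ Conductivities Ω kmin kmax γ ∧
      MemLp r.2 2 (volume.restrict Ω) ∧ localEnergy Ω r.1 r.2 ≤ M) ∧ (δ ∈ S → Good δ r) :=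
    fun δ => by
      by_cases hδ : δ ∈ S
      · obtain ⟨r, hr⟩ := hδ
        exact ⟨r, ⟨hr.1, hr.2.1, hr.2.2.1⟩, fun _ => hr⟩
      · exact ⟨r₀, ⟨hr₀.1, hr₀.2.1, hr₀.2.2.1⟩, fun h => (hδ h).elim⟩
  choose r hr1 hr using hex
  let U : Ultrafilter ℝ := Ultrafilter.of (𝓝[>] (0 : ℝ) ⊓ 𝓟 S)
  have hU : (U : Filter ℝ) ≤ 𝓝[>] (0 : ℝ) ⊓ 𝓟 S := Ultrafilter.of_le _
  have hUS : ∀ᶠ δ in (U : Filter ℝ), δ ∈ S := hU (mem_inf_of_right (mem_principal_self S))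
  have hU0 : Tendsto (fun δ : ℝ => δ) U (𝓝 0) :=
    (hU.trans inf_le_left).trans nhdsWithin_le_nhds
  obtain ⟨κ, p, hκm, hκb, hκγ, hp, hE, hlim⟩ := exists_weak_limit (M := 2 * M) U hkmin hk
    (fun δ => (r δ).1) (fun δ => (r δ).2) (fun δ => (hr1 δ).1.1.1) (fun δ => (hr1 δ).1.2.1)
    (fun δ => (hr1 δ).1.2.2) (fun δ => (hr1 δ).2.1)
    (fun δ => by have := (hr1 δ).2.2; unfold localEnergy at this; linarith)
  have hκ : κ ∈ Conductivities Ω kmin kmax γ := by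
    refine ⟨MemLp.of_bound hκm kmax ?_, hκb, hκγ⟩
    filter_upwards [hκb] with x hx
    rw [Real.norm_of_nonneg (hkmin.le.trans hx.1)]
    exact hx.2
  have hdiv : IsWeakDiv Ω p f := by
    intro φ hφ hc hts
    obtain ⟨L, hL0, hL⟩ := exists_abs_sub_sub_inner_gradient_le hφ hc
    have hg : MemLp (gradient φ) 2 (volume.restrict Ω) :=
      (continuous_gradient hφ).memLp_of_hasCompactSupport (hasCompactSupport_gradient hc)
    have h1 := ((hlim _ hg).const_add (∫ x in Ω, f x * φ x)).pow 2
    -- For a fixed `φ` the constants `C`, `L`, `D` do not depend on `δ`, so the divergence error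
    -- tends to zero.
    have h2 : Tendsto (fun δ : ℝ => C * ((L * δ) ^ 2 * D)) U (𝓝 (C * ((L * 0) ^ 2 * D))) :=
      (((hU0.const_mul L).pow 2).mul_const D).const_mul C
    have h3 : ((∫ x in Ω, f x * φ x) + ∫ x in Ω, inner ℝ (p x) (gradient φ x)) ^ 2 ≤
        C * ((L * 0) ^ 2 * D) := by
      refine le_of_tendsto_of_tendsto h1 h2 ?_
      filter_upwards [hUS] with δ hδ
      exact (hr δ hδ).2.2.2 φ L hφ hc hts hL0 hL
    have h4 : ((∫ x in Ω, f x * φ x) + ∫ x in Ω, inner ℝ (p x) (gradient φ x)) ^ 2 = 0 :=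
      le_antisymm (h3.trans (le_of_eq (by ring))) (sq_nonneg _)
    have h5 := pow_eq_zero_iff (two_ne_zero) |>.1 h4
    linarith
  calc localDualValue Ω kmin kmax γ f ≤ ((localEnergy Ω κ p : ℝ) : EReal) :=
        iInf₂_le_of_le κ hκ (iInf₂_le p ⟨⟨hp, f, hf, hdiv⟩, hdiv⟩)
    _ ≤ (M : EReal) := by
        rw [EReal.coe_le_coe_iff]
        unfold localEnergy
        linarith

end NonlocalDesign

theorem mainTheorem6 {n : ℕ} (hn : 2 ≤ n)
    (Ω : Set (NonlocalDesign.E n)) (hΩo : IsOpen Ω) (hΩb : Bornology.IsBounded Ω)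
    (kmin kmax γ : ℝ) (hkmin : 0 < kmin) (hk : kmin < kmax) (hγ : γ ∈ Set.Ioo kmin kmax)
    (f : NonlocalDesign.E n → ℝ) (hf : MemLp f 2 (volume.restrict Ω))
    (e : NonlocalDesign.E n) (he : ‖e‖ = 1)
    (w : ℝ → NonlocalDesign.E n → ℝ)
    (hw : ∀ δ : ℝ, 0 < δ → NonlocalDesign.IsKernel e δ (w δ)) :
    NonlocalDesign.localDualValue Ω kmin kmax γ f ≤
      liminf (fun δ : ℝ => NonlocalDesign.nonlocalDualValue Ω kmin kmax γ f δ (w δ))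
        (𝓝[>] (0 : ℝ)) := by
  refine le_of_not_gt fun hlt => ?_
  obtain ⟨M, h1, h2⟩ := EReal.lt_iff_exists_real_btwn.1 hlt
  exact absurd (NonlocalDesign.localDualValue_le_of_frequently hΩb hkmin hk hf he hw
    (frequently_lt_of_liminf_lt (by isBoundedDefault) h1)) (not_le.2 h2)
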